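/- For an integer $n>0$ let $$J_n=\{x\cdot x_1\cdots x_k \mid k>0,\ x,x_1,\ldots,x_k\in\{a,b\}^n,\ \exists j\in\{1,\ldots,k\}\colon x_j=x\}.$$ All two-way machines considered here work on the input word $w$ stored in cells $1,\dots,|w|$ of a tape, with a left end-marker in cell $0$ and a right end-marker in cell $|w|+1$. The head starts on cell $1$ in the initial state. In each move the machine, depending (possibly nondeterministically) on the state and on the scanned symbol, changes its state and moves the head one cell to the left or to the right; it cannot move to the left of the left end-marker. The word $w$ is accepted if some computation moves the head to the right of the right end-marker and enters a final state in doing so. A two-way nondeterministic finite automaton (two-way NFA) is such a machine, with finitely many states, that never changes the tape. A 1-limited automaton (1-LA) is such a machine, with finitely many states and a finite work alphabet, that in each move may also replace the scanned symbol; the content of each cell can be modified only during the first visit of the head to it, and the end-markers are never modified. A 1-LA is deterministic if it has at most one transition for each state and each tape symbol. It is always marking if its work alphabet consists of the input symbols $\sigma$, their marked versions $\dot\sigma$ and the end-markers, and each time the head visits a cell that contains an input symbol $\sigma$ for the first time, it replaces $\sigma$ by $\dot\sigma$. **Theorem.** There is a constant $C$ such that, for each integer $n>0$, the language $J_n$ is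 accepted by a deterministic always-marking 1-LA with at most $C\cdot n$ states. For each integer $n>0$, every two-way NFA that accepts $J_n$ has at least $2^{(n-1)/2}$ states. -/

import Mathlib

/-- The two-letter alphabet `{a, b}`. -/
inductive Letter where
  | a
  | b
  deriving DecidableEq

/-- The language `J_n`: words `x · x₁ ⋯ x_k` with `k > 0`, all blocks of length `n`, and
`x = x_j` for some `j`. -/
def J (n : ℕ) : Language Letter :=
  {w | ∃ (x : List Letter) (xs : List (List Letter)),
    x.length = n ∧ 0 < xs.length ∧ (∀ y ∈ xs, y.length = n) ∧ x ∈ xs ∧ w = x ++ xs.flatten}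

/-- Content of a tape cell: one of the two end-markers, or a symbol of `β`. -/
inductive TapeSymbol (β : Type*) where
  | lend
  | rend
  | sym (s : β)

/-- The content of cell `i` of the tape `⊢ t ⊣`: the left end-marker is in cell `0`, `t` occupies
the cells `1, …, |t|`, and the right end-marker is in cell `|t| + 1`. There are no other cells. -/
def readCell {β : Type*} (t : List β) : ℕ → Option (TapeSymbol β)
  | 0 => some .lend
  | i + 1 =>
    if h : i < t.length then some (.sym t[i])
    else if i = t.length then some .rend
    else none

/-- Write `s` in cell `i` of the tape `⊢ t ⊣`. The end-markers are never modified: nothing happens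
for `i = 0`, nor for `i = |t| + 1`, where `List.set` is out of range. -/
def writeCell {β : Type*} (t : List β) (i : ℕ) (s : β) : List β :=
  match i with
  | 0 => t
  | j + 1 => t.set j s

/-- Head movements `-1` and `+1`. -/
inductive Dir where
  | left
  | right
  deriving DecidableEq

/-- The head position after a move; the head cannot pass the left end-marker. -/
def Dir.move : Dir → ℕ → Option ℕ
  | .left, 0 => none
  | .left, p + 1 => some p
  | .right, p => some (p + 1)

/-! ### Two-way nondeterministic finite automata -/

/-- A two-way nondeterministic finite automaton over the input alphabet `α` with state set `Q`,
reading the input between two end-markers. -/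
structure TwoWayNFA (α Q : Type*) where
  /-- the transition function -/
  δ : Q → TapeSymbol α → Set (Q × Dir)
  /-- the initial state -/
  start : Q
  /-- the final states -/
  final : Set Q

namespace TwoWayNFA

variable {α Q : Type*}

/-- One move on input `w`; a configuration is a pair (state, head position). There is no move
from a position outside the tape, so the computation stops once the right end-marker is passed. -/
def Step (A : TwoWayNFA α Q) (w : List α) (c c' : Q × ℕ) : Prop :=
  ∃ s d, readCell w c.2 = some s ∧ (c'.1, d) ∈ A.δ c.1 s ∧ d.move c.2 = some c'.2

/-- `c` occurs in a computation on `w`: it is reachable from the initial state with the head on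
cell `1`. -/
def Reachable (A : TwoWayNFA α Q) (w : List α) (c : Q × ℕ) : Prop :=
  Relation.ReflTransGen (A.Step w) (A.start, 1) c

/-- The accepted language: some computation passes the right end-marker (in cell `|w| + 1`) and
ends in a final state. -/
def language (A : TwoWayNFA α Q) : Language α :=
  {w | ∃ q ∈ A.final, A.Reachable w (q, w.length + 2)}

end TwoWayNFA

/-! ### 1-limited automata -/

/-- A two-way automaton that may rewrite its tape. The work alphabet consists of the input
alphabet `α`, the additional work symbols `X`, and the two end-markers. A transition gives the new
state, the symbol (not an end-marker) to write and the head movement. -/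
structure RewritingAutomaton (α X Q : Type*) where
  /-- the transition function -/
  δ : Q → TapeSymbol (α ⊕ X) → Set (Q × (α ⊕ X) × Dir)
  /-- the initial state -/
  start : Q
  /-- the final states -/
  final : Set Q

namespace RewritingAutomaton

variable {α X Q : Type*}

/-- A configuration: state, head position, the current content of the tape between the
end-markers, and the set of the cells that the head visited before the current moment. -/
structure Config (α X Q : Type*) where
  state : Q
  pos : ℕ
  tape : List (α ⊕ X)
  visited : Set ℕ

/-- The initial configuration on input `w`, with the head on cell `1`. -/
def init (M : RewritingAutomaton α X Q) (w : List α) : Config α X Q where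
  state := M.start
  pos := 1
  tape := w.map Sum.inl
  visited := ∅

/-- One move: read, change state, write, move the head. There is no move from a position outside
the tape, so the computation stops once the right end-marker is passed. -/
def Step (M : RewritingAutomaton α X Q) (c c' : Config α X Q) : Prop :=
  ∃ s g d, readCell c.tape c.pos = some s ∧ (c'.state, g, d) ∈ M.δ c.state s ∧
    d.move c.pos = some c'.pos ∧ c'.tape = writeCell c.tape c.pos g ∧
    c'.visited = insert c.pos c.visited

/-- `c` occurs in a computation on input `w`. -/
def Reachable (M : RewritingAutomaton α X Q) (w : List α) (c : Config α X Q) : Prop :=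
  Relation.ReflTransGen M.Step (M.init w) c

/-- The accepted language: some computation passes the right end-marker (in cell `|w| + 1`) and
ends in a final state. -/
def language (M : RewritingAutomaton α X Q) : Language α :=
  {w | ∃ c, M.Reachable w c ∧ c.state ∈ M.final ∧ c.pos = w.length + 2}

/-- `M` is a 1-limited automaton: the content of a cell is modified only during the first visit. -/
def IsOneLimited (M : RewritingAutomaton α X Q) : Prop :=
  ∀ w c c', M.Reachable w c → M.Step c c' → c.pos ∈ c.visited → c'.tape = c.tape

/-- At most one transition for each state and each tape symbol. -/
def IsDeterministic (M : RewritingAutomaton α X Q) : Prop :=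
  ∀ q s, (M.δ q s).Subsingleton

/-- `M` is always marking. The additional work symbols are the marked versions of the input
symbols: `Sum.inr σ` is the marked version of `σ`. Whenever the head is on a cell for the first
time, the move replaces the input symbol in it by its marked version. -/
def IsAlwaysMarking (M : RewritingAutomaton α α Q) : Prop :=
  ∀ w c c', M.Reachable w c → M.Step c c' → c.pos ∉ c.visited →
    ∀ σ : α, readCell c.tape c.pos = some (.sym (Sum.inl σ)) →
      readCell c'.tape c.pos = some (.sym (Sum.inr σ))

end RewritingAutomaton

/-! Lower bound: once a word is split as `u ++ v`, an automaton with `m` states interacts with `v`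
only through which entry states can lead to which exit states and which entry states can lead to
acceptance. This leaves at most `2 ^ (m * m + m)` behaviours, and suffixes with equal behaviour are
interchangeable (`mem_language_exchange`). Each set `S` of words of length `n` yields the suffix
`concatBlocks S`, and the prefix `x` tests whether `x ∈ S`. The `2 ^ (2 ^ n)` sets therefore have
distinct behaviours, so `2 ^ n ≤ m * m + m ≤ 2 * m ^ 2`.

Upper bound: the border between marked and unmarked cells remembers the current place for free, so
the state needs only a phase and a counter modulo `n`. A letter at index `i` of a block is carried
to the left end-marker and then to cell `i + 1` while the counter falls to zero. The way back to the
end-marker restores `i`, and a scan over the marked cells finds the next letter. Each such round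
trip acts on the state as `scanLetter` (`leads_scanLetter`), so a whole run is a fold over the
input, and `mem_J_iff_foldl_scanLetter` identifies this fold with membership in `J n`. Determinism
excludes every other accepting computation. -/

open Relation

/-! ### Exchanging suffixes in two-way computations -/

namespace TwoWayNFA

variable {α Q : Type*}

/-- One move on `v` that starts strictly to the right of the left end-marker. -/
def InnerStep (A : TwoWayNFA α Q) (v : List α) (c c' : Q × ℕ) : Prop :=
  A.Step v c c' ∧ 1 ≤ c.2

/-- The behaviour of `A` on a suffix `v`, entered from the left: the pairs (entry state, exit state)
of the computations that leave `v` to the left, and the entry states that lead to acceptance. -/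
def suffixBehaviour (A : TwoWayNFA α Q) (v : List α) : Set (Q × Q) × Set Q :=
  ({r | ReflTransGen (A.InnerStep v) (r.1, 1) (r.2, 0)},
    {p | ∃ f ∈ A.final, ReflTransGen (A.InnerStep v) (p, 1) (f, v.length + 2)})

end TwoWayNFA

theorem readCell_append_right {α : Type*} (u v : List α) (i : ℕ) (hi : 1 ≤ i) :
    readCell (u ++ v) (u.length + i) = readCell v i := by
  obtain ⟨i, rfl⟩ := Nat.exists_eq_add_of_le' hi
  rw [← add_assoc]
  simp only [readCell, List.length_append, Nat.add_lt_add_iff_left, Nat.add_left_cancel_iff]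
  simp

theorem readCell_append_left {α : Type*} (u v : List α) (i : ℕ) (hi : i ≤ u.length) :
    readCell (u ++ v) i = (readCell u i) := by
  cases i with
  | zero => rfl
  | succ i =>
    have h : i < u.length := hi
    simp [readCell, h, Nat.lt_add_right]

theorem Dir.move_add {d : Dir} {i j : ℕ} (k : ℕ) (hi : 1 ≤ i) :
    d.move (k + i) = some (k + j) ↔ d.move i = some j := by
  obtain ⟨i, rfl⟩ := Nat.exists_eq_add_of_le' hi
  cases d
  · simp [Dir.move]
  · simp [Dir.move]
    omega

namespace TwoWayNFA

variable {α Q : Type*}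

/-- Position `0` of `v` stands for the last cell of `u`. A move may end there but not start there,
so the left end-marker of `v` is never read. -/
theorem step_append_iff (A : TwoWayNFA α Q) (u v : List α) (p q : Q) {i j : ℕ} (hi : 1 ≤ i) :
    A.Step (u ++ v) (p, u.length + i) (q, u.length + j) ↔ A.InnerStep v (p, i) (q, j) := by
  simp [Step, InnerStep, readCell_append_right u v i hi, Dir.move_add _ hi, hi]

theorem reflTransGen_append_of_inner (A : TwoWayNFA α Q) (u v : List α) {c c' : Q × ℕ}
    (h : ReflTransGen (A.InnerStep v) c c') :
    ReflTransGen (A.Step (u ++ v)) (c.1, u.length + c.2) (c'.1, u.length + c'.2) :=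
  h.lift (fun c : Q × ℕ => (c.1, u.length + c.2))
    fun _ _ h => (A.step_append_iff u v _ _ h.2).2 h

theorem pos_near_of_step {A : TwoWayNFA α Q} {w : List α} {c c' : Q × ℕ} (h : A.Step w c c') :
    c.2 ≤ c'.2 + 1 ∧ c'.2 ≤ c.2 + 1 := by
  obtain ⟨s, d, -, -, h⟩ := h
  rcases hc : c.2 with _ | i <;> rw [hc] at h <;> cases d <;> simp [Dir.move] at h <;> omega

/-- Suffixes with the same behaviour can be exchanged without changing the part of a computation
that takes place on the prefix. -/
theorem reachable_exchange (A : TwoWayNFA α Q) {u v v' : List α} (hu : 1 ≤ u.length)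
    (h : A.suffixBehaviour v = A.suffixBehaviour v') {c : Q × ℕ} (hc : A.Reachable (u ++ v) c) :
    (c.2 ≤ u.length ∧ A.Reachable (u ++ v') c) ∨
    ∃ p i, 1 ≤ i ∧ c.2 = u.length + i ∧ A.Reachable (u ++ v') (p, u.length + 1) ∧
      ReflTransGen (A.InnerStep v) (p, 1) (c.1, i) := by
  induction hc with
  | refl => exact .inl ⟨hu, .refl⟩
  | @tail b c _ hbc ih =>
    obtain ⟨c1, c2⟩ := c
    obtain ⟨b1, b2⟩ := b
    have hpos := pos_near_of_step hbc
    rcases ih with ⟨hb, hr⟩ | ⟨p, i, hi, hb, hr, hin⟩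
    · have hstep : A.Step (u ++ v') (b1, b2) (c1, c2) := by
        obtain ⟨s, d, h1, h2, h3⟩ := hbc
        exact ⟨s, d, by rwa [readCell_append_left _ _ _ hb] at h1 ⊢, h2, h3⟩
      have hr' := hr.tail hstep
      by_cases hle : c2 ≤ u.length
      · exact .inl ⟨hle, hr'⟩
      -- The head moves by one cell, so it enters the suffix on its first cell.
      · have hc2 : c2 = u.length + 1 := by dsimp at hpos hb; omega
        subst hc2
        exact .inr ⟨c1, 1, le_rfl, rfl, hr', .refl⟩
    · dsimp at hb hpos
      subst hb
      obtain ⟨j, rfl⟩ : ∃ j, c2 = u.length + j := ⟨c2 - u.length, by omega⟩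
      have hin' := hin.tail ((A.step_append_iff u v _ _ hi).1 hbc)
      -- For `j = 0` the excursion is over: its pair of entry and exit states belongs to the
      -- behaviour, hence can be realised on `v'`.
      rcases Nat.eq_zero_or_pos j with rfl | hj
      · have hmem : (p, c1) ∈ (A.suffixBehaviour v).1 := hin'
        rw [h] at hmem
        exact .inl ⟨le_rfl, ReflTransGen.trans hr (A.reflTransGen_append_of_inner u v' hmem)⟩
      · exact .inr ⟨p, j, hj, rfl, hr, hin'⟩

/-- An accepting computation ends to the right of `u`, so its last entry into `v` is from a state in
the second component of the behaviour. The final state reached on `v'` may be a different one. -/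
theorem mem_language_exchange (A : TwoWayNFA α Q) {u v v' : List α} (hu : 1 ≤ u.length)
    (h : A.suffixBehaviour v = A.suffixBehaviour v') (hv : u ++ v ∈ A.language) :
    u ++ v' ∈ A.language := by
  obtain ⟨f, hf, hr⟩ := hv
  rcases A.reachable_exchange hu h hr with ⟨hle, -⟩ | ⟨p, i, -, hi, hr', hin⟩
  · simp at hle
    omega
  · obtain rfl : i = v.length + 2 := by simp at hi; omega
    have hmem : p ∈ (A.suffixBehaviour v).2 := ⟨f, hf, hin⟩
    rw [h] at hmem
    obtain ⟨g, hg, hin'⟩ := hmem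
    refine ⟨g, hg, ?_⟩
    have := ReflTransGen.trans hr' (A.reflTransGen_append_of_inner u v' hin')
    rwa [← add_assoc, ← List.length_append] at this

end TwoWayNFA

/-! ### The counting argument for the lower bound -/

instance : Fintype Letter := ⟨{.a, .b}, fun x => by cases x <;> simp⟩

/-- The concatenation of the words in a finite set of words of length `n`. -/
noncomputable def concatBlocks {n : ℕ} (S : Finset (Fin n → Letter)) : List Letter :=
  (S.toList.map List.ofFn).flatten

/-- As `n > 0`, the total length fixes the number of blocks, hence all the places to cut. -/
theorem eq_of_flatten_eq_of_length {α : Type*} {n : ℕ} (hn : 0 < n) {L L' : List (List α)}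
    (hL : ∀ y ∈ L, y.length = n) (hL' : ∀ y ∈ L', y.length = n) (h : L.flatten = L'.flatten) :
    L = L' := by
  have e : L.map List.length = List.replicate L.length n := by
    rw [List.eq_replicate_iff]; simpa using hL
  have e' : L'.map List.length = List.replicate L'.length n := by
    rw [List.eq_replicate_iff]; simpa using hL'
  have hlen := congrArg List.length h
  rw [List.length_flatten, List.length_flatten, e, e'] at hlen
  simp only [List.sum_replicate, smul_eq_mul] at hlen
  refine List.eq_iff_flatten_eq.2 ⟨h, ?_⟩
  rw [e, e', Nat.eq_of_mul_eq_mul_right hn hlen]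

theorem ofFn_append_concatBlocks_mem_J_iff {n : ℕ} (hn : 0 < n) (x : Fin n → Letter)
    (S : Finset (Fin n → Letter)) : List.ofFn x ++ concatBlocks S ∈ J n ↔ x ∈ S := by
  constructor
  · rintro ⟨y, ys, hy, -, hys, hmem, h⟩
    obtain ⟨h1, h2⟩ := List.append_inj h (by simp [hy])
    have := eq_of_flatten_eq_of_length hn (by simp) hys h2
    rw [← this, ← h1] at hmem
    obtain ⟨z, hz, hzx⟩ := List.mem_map.1 hmem
    rw [List.ofFn_injective hzx] at hz
    simpa using hz
  · intro hx
    have hx' : List.ofFn x ∈ S.toList.map List.ofFn := List.mem_map_of_mem (by simpa using hx)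
    exact ⟨List.ofFn x, S.toList.map List.ofFn, by simp, List.length_pos_of_mem hx', by simp, hx',
      rfl⟩

theorem two_pow_le_of_language_eq_J {n : ℕ} (hn : 0 < n) {Q : Type*} [Fintype Q]
    (A : TwoWayNFA Letter Q) (hA : A.language = J n) :
    2 ^ n ≤ Fintype.card Q * Fintype.card Q + Fintype.card Q := by
  classical
  have hinj : Function.Injective
      fun S : Finset (Fin n → Letter) => A.suffixBehaviour (concatBlocks S) := by
    intro S T h
    ext x
    have hlen : 1 ≤ (List.ofFn x).length := by simpa using Nat.one_le_iff_ne_zero.2 hn.ne'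
    rw [← ofFn_append_concatBlocks_mem_J_iff hn, ← ofFn_append_concatBlocks_mem_J_iff hn, ← hA]
    exact ⟨A.mem_language_exchange hlen h, A.mem_language_exchange hlen h.symm⟩
  have hcard := Fintype.card_le_of_injective _ hinj
  have hL : Fintype.card Letter = 2 := rfl
  rw [Fintype.card_finset, Fintype.card_fun, hL, Fintype.card_fin, Fintype.card_prod,
    Fintype.card_set, Fintype.card_set, Fintype.card_prod, ← pow_add] at hcard
  exact (Nat.pow_le_pow_iff_right (by norm_num)).1 hcard

theorem rpow_le_card_of_language_eq_J {n : ℕ} (hn : 0 < n) {Q : Type*} [Fintype Q]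
    (A : TwoWayNFA Letter Q) (hA : A.language = J n) :
    (2 : ℝ) ^ (((n : ℝ) - 1) / 2) ≤ (Fintype.card Q : ℝ) := by
  have h := two_pow_le_of_language_eq_J hn A hA
  -- The initial state gives `m ≥ 1`, which turns `m * m + m` into at most `2 * m ^ 2`.
  have hpos : 0 < Fintype.card Q := Fintype.card_pos_iff.2 ⟨A.start⟩
  have h2 : 2 ^ n ≤ 2 * Fintype.card Q ^ 2 := by nlinarith
  have h2' : (2 : ℝ) ^ n ≤ 2 * (Fintype.card Q : ℝ) ^ 2 := by exact_mod_cast h2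
  refine le_of_sq_le_sq ?_ (Nat.cast_nonneg _)
  rw [← Real.rpow_natCast, ← Real.rpow_mul (by norm_num)]
  have : ((n : ℝ) - 1) / 2 * (2 : ℕ) = n - 1 := by push_cast; ring
  rw [this, Real.rpow_sub_one (by norm_num), Real.rpow_natCast]
  linarith

/-! ### Deterministic always-marking automata -/

/-- The symbol that an always marking automaton writes: the marked version of the scanned symbol.
On the end-markers the choice is irrelevant. -/
def TapeSymbol.mark : TapeSymbol (Letter ⊕ Letter) → Letter ⊕ Letter
  | .sym (.inl σ) => .inr σ
  | .sym (.inr σ) => .inr σ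
  | _ => .inr .a

theorem readCell_writeCell_of_ne {β : Type*} (t : List β) {i j : ℕ} (s : β) (h : i ≠ j) :
    readCell (writeCell t i s) j = readCell t j := by
  rcases i with _ | i
  · rfl
  · rcases j with _ | j
    · rfl
    · have : i ≠ j := fun e => h (by rw [e])
      simp [readCell, writeCell, this]

theorem lt_length_of_readCell_eq_sym {β : Type*} {t : List β} {i : ℕ} {s : β}
    (h : readCell t (i + 1) = some (.sym s)) : ∃ hi : i < t.length, t[i] = s := by
  simp only [readCell] at h
  split_ifs at h with h1 h2
  · exact ⟨h1, by simpa using h⟩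
  · simp at h

theorem readCell_writeCell_of_sym {β : Type*} {t : List β} {i : ℕ} {s r : β}
    (h : readCell t i = some (.sym r)) : readCell (writeCell t i s) i = some (.sym s) := by
  rcases i with _ | i
  · simp [readCell] at h
  · obtain ⟨hi, -⟩ := lt_length_of_readCell_eq_sym h
    simp [readCell, writeCell, hi]

theorem writeCell_of_sym {β : Type*} {t : List β} {i : ℕ} {s : β}
    (h : readCell t i = some (.sym s)) : writeCell t i s = t := by
  rcases i with _ | i
  · rfl
  · obtain ⟨hi, rfl⟩ := lt_length_of_readCell_eq_sym h
    simp [writeCell]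

theorem writeCell_of_lend {β : Type*} {t : List β} {i : ℕ} (s : β)
    (h : readCell t i = some .lend) : writeCell t i s = t := by
  rcases i with _ | i
  · rfl
  · simp only [readCell] at h
    split_ifs at h <;> simp at h

theorem writeCell_of_rend {β : Type*} {t : List β} {i : ℕ} (s : β)
    (h : readCell t i = some .rend) : writeCell t i s = t := by
  rcases i with _ | i
  · rfl
  · simp only [readCell] at h
    split_ifs at h with h1 h2
    · simp at h
    · simp [writeCell, List.set_eq_of_length_le, h2]

namespace RewritingAutomaton

variable {Q : Type*}

/-- The deterministic always marking automaton with the given moves. -/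
def marking (move : Q → TapeSymbol (Letter ⊕ Letter) → Option (Q × Dir)) (start : Q)
    (final : Set Q) : RewritingAutomaton Letter Letter Q where
  δ q s := {r | move q s = some (r.1, r.2.2) ∧ r.2.1 = s.mark}
  start := start
  final := final

variable (move : Q → TapeSymbol (Letter ⊕ Letter) → Option (Q × Dir)) (start : Q) (final : Set Q)

theorem marking_isDeterministic : (marking move start final).IsDeterministic := by
  rintro q s ⟨q₁, g₁, d₁⟩ ⟨h₁, h₁'⟩ ⟨q₂, g₂, d₂⟩ ⟨h₂, h₂'⟩
  simp_all

theorem marking_isAlwaysMarking : (marking move start final).IsAlwaysMarking := by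
  rintro w c c' - ⟨s, g, d, hs, ⟨-, hg⟩, -, ht, -⟩ - σ hσ
  rw [hs, Option.some_inj] at hσ
  subst hσ
  dsimp at hg
  rw [ht, readCell_writeCell_of_sym hs, hg]
  rfl

/-- This invariant makes the automaton 1-limited: on a visited cell the scanned symbol is already
marked or an end-marker, and writing changes neither. -/
theorem marking_visited {w : List Letter} {c : Config Letter Letter Q}
    (h : (marking move start final).Reachable w c) :
    ∀ p ∈ c.visited, ∀ σ, readCell c.tape p ≠ some (.sym (.inl σ)) := by
  induction h with
  | refl => simp [init]
  | @tail b c _ hbc ih =>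
    obtain ⟨s, g, d, hs, ⟨-, hg⟩, -, ht, hv⟩ := hbc
    dsimp at hg
    intro p hp σ
    rw [ht]
    rw [hv] at hp
    by_cases hpb : b.pos = p
    · subst hpb
      rcases s with _ | _ | _ | _
      · rw [writeCell_of_lend _ hs, hs]; simp
      · rw [writeCell_of_rend _ hs, hs]; simp
      all_goals rw [readCell_writeCell_of_sym hs, hg]; simp [TapeSymbol.mark]
    · rw [readCell_writeCell_of_ne _ _ hpb]
      exact ih p (hp.resolve_left (Ne.symm hpb)) σ

theorem marking_isOneLimited : (marking move start final).IsOneLimited := by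
  rintro w c c' hr ⟨s, g, d, hs, ⟨-, hg⟩, -, ht, hv⟩ hp
  have hne := marking_visited move start final hr _ hp
  dsimp at hg
  rw [ht]
  rcases s with _ | _ | σ | σ
  · exact writeCell_of_lend _ hs
  · exact writeCell_of_rend _ hs
  · exact absurd hs (hne σ)
  · rw [hg]
    exact writeCell_of_sym hs

theorem step_rightUnique_of_isDeterministic {α X : Type*} {M : RewritingAutomaton α X Q}
    (h : M.IsDeterministic) : Relator.RightUnique M.Step := by
  rintro ⟨q, p, t, V⟩ ⟨q₁, p₁, t₁, V₁⟩ ⟨q₂, p₂, t₂, V₂⟩ ⟨s, g, d, hs, hδ, hd, ht, hV⟩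
    ⟨s', g', d', hs', hδ', hd', ht', hV'⟩
  obtain rfl : s = s' := Option.some_inj.1 (hs.symm.trans hs')
  have := h _ _ hδ hδ'
  simp_all

/-- A computation between two configurations, irrespective of the set of visited cells. -/
def Leads {α X : Type*} (M : RewritingAutomaton α X Q) (t : List (α ⊕ X)) (q : Q) (p : ℕ)
    (t' : List (α ⊕ X)) (q' : Q) (p' : ℕ) : Prop :=
  ∀ V, ∃ V', ReflTransGen M.Step ⟨q, p, t, V⟩ ⟨q', p', t', V'⟩

section Leads

variable {α X : Type*} {M : RewritingAutomaton α X Q} {t t₁ t₂ : List (α ⊕ X)} {q q₁ q₂ : Q}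
  {p p₁ p₂ : ℕ}

theorem Leads.refl : M.Leads t q p t q p := fun V => ⟨V, .refl⟩

theorem Leads.trans (h₁ : M.Leads t q p t₁ q₁ p₁) (h₂ : M.Leads t₁ q₁ p₁ t₂ q₂ p₂) :
    M.Leads t q p t₂ q₂ p₂ := fun V =>
  let ⟨V₁, h⟩ := h₁ V
  let ⟨V₂, h'⟩ := h₂ V₁
  ⟨V₂, h.trans h'⟩

end Leads

variable {move start final}

theorem leads_of_move {t : List (Letter ⊕ Letter)} {q q' : Q} {p p' : ℕ}
    {s : TapeSymbol (Letter ⊕ Letter)} {d : Dir} (hs : readCell t p = some s)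
    (hm : move q s = some (q', d)) (hd : d.move p = some p') :
    (marking move start final).Leads t q p (writeCell t p s.mark) q' p' := fun V =>
  ⟨insert p V, .single ⟨s, s.mark, d, hs, ⟨hm, rfl⟩, hd, rfl, rfl⟩⟩

end RewritingAutomaton

/-! ### The tape during a left-to-right scan -/

/-- The tape on input `w` after the first `p` cells have been marked. -/
def markedTape (w : List Letter) (p : ℕ) : List (Letter ⊕ Letter) :=
  w.mapIdx fun j σ => if j < p then .inr σ else .inl σ

theorem markedTape_zero (w : List Letter) : markedTape w 0 = w.map Sum.inl := by
  simp [markedTape, List.mapIdx_eq_iff]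

theorem readCell_markedTape_of_lt {w : List Letter} {p j : ℕ} (hj : j < p) (hw : j < w.length) :
    readCell (markedTape w p) (j + 1) = some (.sym (.inr w[j])) := by
  simp [readCell, markedTape, hj, hw]

theorem readCell_markedTape_self {w : List Letter} {p : ℕ} (hw : p < w.length) :
    readCell (markedTape w p) (p + 1) = some (.sym (.inl w[p])) := by
  simp [readCell, markedTape, hw]

theorem readCell_markedTape_end (w : List Letter) (p : ℕ) :
    readCell (markedTape w p) (w.length + 1) = some .rend := by
  simp [readCell, markedTape]

theorem writeCell_markedTape_self {w : List Letter} {p : ℕ} (hw : p < w.length) :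
    writeCell (markedTape w p) (p + 1) (.inr w[p]) = markedTape w (p + 1) := by
  refine List.ext_getElem (by simp [writeCell, markedTape]) fun j h₁ h₂ => ?_
  simp only [writeCell, markedTape, List.getElem_set, List.getElem_mapIdx]
  rcases lt_trichotomy j p with h | rfl | h
  · simp [h, h.ne', Nat.lt_succ_of_lt h]
  · simp
  · simp [h.ne, Nat.not_lt.2 h.le, Nat.not_lt.2 (Nat.succ_le_of_lt h)]

/-! ### The automaton -/

/-- What the automaton is doing; its states combine this with a counter modulo `n`. -/
inductive Phase where
  /-- pass the rest of the block without looking at it -/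
  | skip
  /-- compare the block with the first one, all letters so far being equal -/
  | cmp
  /-- an occurrence of the first block has been found -/
  | done
  /-- carry a letter to the left end-marker -/
  | back (σ : Letter)
  /-- carry a letter to its position in the first block -/
  | down (σ : Letter)
  /-- carry the result of the comparison to the left end-marker, counting the moves -/
  | up (r : Bool)

instance : Finite Phase := by
  refine Finite.of_injective (β := Fin 6 × Bool) (fun
    | .skip => (0, true) | .cmp => (1, true) | .done => (2, true)
    | .back σ => (3, decide (σ = .a)) | .down σ => (4, decide (σ = .a)) | .up r => (5, r)) ?_
  rintro (_ | _ | _ | (_ | _) | (_ | _) | _) (_ | _ | _ | (_ | _) | (_ | _) | _) <;> simp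

noncomputable instance : Fintype Phase := Fintype.ofFinite _

/-- The state after the comparison, with result `r`, at position `i` of the block. -/
def afterCompare {n : ℕ} [NeZero n] (r : Bool) (i : Fin n) : Phase × Fin n :=
  (if i.val + 1 < n then (if r then .cmp else .skip) else (if r then .done else .cmp), i + 1)

/-- The moves of the automaton for `J n`. -/
def blockMove (n : ℕ) [NeZero n] :
    Phase × Fin n → TapeSymbol (Letter ⊕ Letter) → Option ((Phase × Fin n) × Dir)
  | (.skip, i), .sym (.inl _) => some (afterCompare false i, .right)
  | (.cmp, i), .sym (.inl σ) => some ((.back σ, i), .left)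
  | (.done, i), .sym (.inl _) => some ((.done, i + 1), .right)
  | (.skip, i), .sym (.inr _) => some ((.skip, i), .right)
  | (.cmp, i), .sym (.inr _) => some ((.cmp, i), .right)
  | (.done, i), .sym (.inr _) => some ((.done, i), .right)
  | (.done, i), .rend => if i = 0 then some ((.done, i), .right) else none
  | (.back σ, i), .sym (.inr _) => some ((.back σ, i), .left)
  | (.back σ, i), .lend => some ((.down σ, i), .right)
  | (.down σ, i), .sym (.inr τ) =>
    if i = 0 then some ((.up (σ = τ), 0), .left) else some ((.down σ, i - 1), .right)
  | (.up r, i), .sym (.inr _) => some ((.up r, i + 1), .left)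
  | (.up r, i), .lend => some (afterCompare r i, .right)
  | _, _ => none

/-- The automaton for `J n`. -/
def blockAutomaton (n : ℕ) [NeZero n] : RewritingAutomaton Letter Letter (Phase × Fin n) :=
  .marking (blockMove n) (.skip, 0) {(.done, 0)}

/-- The effect on the state of processing one new letter, when the first block is `x`. -/
def scanLetter {n : ℕ} [NeZero n] (x : List Letter) : Phase × Fin n → Letter → Phase × Fin n
  | (.skip, i), _ => afterCompare false i
  | (.cmp, i), σ => afterCompare (x[i.val]? = some σ) i
  | (_, i), _ => (.done, i + 1)

/-- The phases in which the automaton moves to the next new letter. -/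
def Phase.IsScan : Phase → Prop
  | .skip | .cmp | .done => True
  | _ => False

/-! ### Runs between consecutive new letters -/

section Run

open RewritingAutomaton

variable {n : ℕ} [NeZero n] {w : List Letter}

theorem leads_markedTape {q q' : Phase × Fin n} {p j p' : ℕ} {d : Dir} (hj : j < p)
    (hw : j < w.length) (hm : blockMove n q (.sym (.inr w[j])) = some (q', d))
    (hd : d.move (j + 1) = some p') :
    (blockAutomaton n).Leads (markedTape w p) q (j + 1) (markedTape w p) q' p' := by
  have hs := readCell_markedTape_of_lt hj hw
  have := leads_of_move (start := (.skip, 0)) (final := {(.done, 0)}) hs hm hd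
  rwa [show (TapeSymbol.sym (Sum.inr w[j])).mark = Sum.inr w[j] from rfl,
    writeCell_of_sym hs] at this

theorem leads_frontier {q q' : Phase × Fin n} {p p' : ℕ} {d : Dir}
    (hw : p < w.length) (hm : blockMove n q (.sym (.inl w[p])) = some (q', d))
    (hd : d.move (p + 1) = some p') :
    (blockAutomaton n).Leads (markedTape w p) q (p + 1) (markedTape w (p + 1)) q' p' := by
  have := leads_of_move (start := (.skip, 0)) (final := {(.done, 0)})
    (readCell_markedTape_self hw) hm hd
  rwa [show (TapeSymbol.sym (Sum.inl w[p])).mark = Sum.inr w[p] from rfl,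
    writeCell_markedTape_self hw] at this

theorem leads_lend {q q' : Phase × Fin n} {t : List (Letter ⊕ Letter)}
    (hm : blockMove n q .lend = some (q', .right)) :
    (blockAutomaton n).Leads t q 0 t q' 1 :=
  leads_of_move (start := (.skip, 0)) (final := {(.done, 0)}) (t := t) (p := 0) rfl hm rfl

theorem leads_scan {q : Phase × Fin n} (hq : q.1.IsScan) {p : ℕ} (hp : p ≤ w.length) :
    ∀ k j, j + k = p →
      (blockAutomaton n).Leads (markedTape w p) q (j + 1) (markedTape w p) q (p + 1)
  | 0, j, h => by
    obtain rfl : j = p := h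
    exact .refl
  | k + 1, j, h => by
    refine .trans (leads_markedTape (d := .right) (by omega) (by omega) ?_ rfl)
      (leads_scan hq hp k (j + 1) (by omega))
    obtain ⟨_ | _ | _ | _ | _ | _, i⟩ := q <;> first | rfl | exact hq.elim

theorem leads_back (σ : Letter) (i : Fin n) {p : ℕ} (hp : p ≤ w.length) :
    ∀ k ≤ p, (blockAutomaton n).Leads (markedTape w p) (.back σ, i) k
      (markedTape w p) (.down σ, i) 1
  | 0, _ => leads_lend rfl
  | k + 1, h => .trans (leads_markedTape (d := .left) (by omega) (by omega) rfl rfl)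
      (leads_back σ i hp k (by omega))

/-- The counter gains one per cell and does not wrap around, since the sum is the value of `i' : Fin
n`. Started with counter `0` on cell `k`, it recovers `k`. -/
theorem leads_up (r : Bool) {p : ℕ} (hp : p ≤ w.length) :
    ∀ k ≤ p, ∀ i i' : Fin n, i.val + k = i'.val →
      (blockAutomaton n).Leads (markedTape w p) (.up r, i) k
        (markedTape w p) (afterCompare r i') 1
  | 0, _, i, i', h => by
    obtain rfl : i = i' := Fin.ext h
    exact leads_lend rfl
  | k + 1, hk, i, i', h => by
    refine .trans (leads_markedTape (d := .left) (by omega) (by omega) rfl rfl)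
      (leads_up r hp k (by omega) (i + 1) i' ?_)
    have := i'.isLt
    rw [Fin.val_add_one_of_lt' (by omega)]
    omega

/-- The counter vanishes on cell `j + k + 1`, which holds `w[j + k]`; the comparison there turns the
head back to cell `j + k`. -/
theorem leads_down (σ : Letter) {p : ℕ} (hp : p ≤ w.length) :
    ∀ k j, ∀ i : Fin n, i.val = k → j + k < p →
      (blockAutomaton n).Leads (markedTape w p) (.down σ, i) (j + 1)
        (markedTape w p) (.up (w[j + k]? = some σ), 0) (j + k)
  | 0, j, i, hi, hj => by
    obtain rfl : i = 0 := Fin.ext hi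
    refine leads_markedTape (d := .left) (by omega) (by omega) ?_ rfl
    have : j < w.length := by omega
    simp [blockMove, this, eq_comm]
  | k + 1, j, i, hi, hj => by
    have hi0 : i ≠ 0 := by rintro rfl; simp at hi
    have := leads_down σ hp k (j + 1) (i - 1) (by rw [Fin.val_sub_one_of_ne_zero hi0]; omega)
      (by omega)
    rw [show j + (k + 1) = j + 1 + k by ring]
    refine .trans (leads_markedTape (d := .right) (by omega) (by omega) ?_ rfl) this
    simp [blockMove, hi0]

theorem isScan_afterCompare (r : Bool) (i : Fin n) : (afterCompare r i).1.IsScan := by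
  unfold afterCompare
  cases r <;> dsimp <;> split_ifs <;> trivial

theorem isScan_scanLetter (x : List Letter) (q : Phase × Fin n) (σ : Letter) :
    (scanLetter x q σ).1.IsScan := by
  obtain ⟨_ | _ | _ | _ | _ | _, i⟩ := q <;>
    first | exact isScan_afterCompare _ _ | trivial

/-- In phase `cmp` this is the full round trip. The bound `hcmp` ensures that the cell `i + 1` to
compare with is marked once the new letter has been marked. -/
theorem leads_scanLetter {q : Phase × Fin n} (hq : q.1.IsScan) {p : ℕ} (hp : p < w.length)
    (hcmp : q.1 = .cmp → q.2.val ≤ p) :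
    (blockAutomaton n).Leads (markedTape w p) q (p + 1)
      (markedTape w (p + 1)) (scanLetter w q w[p]) (p + 1 + 1) := by
  obtain ⟨_ | _ | _ | _ | _ | _, i⟩ := q
  · exact leads_frontier (d := .right) hp rfl rfl
  · have hi := hcmp rfl
    dsimp at hi
    refine .trans (leads_frontier (d := .left) hp rfl rfl) ?_
    refine .trans (leads_back _ i hp p (by omega)) ?_
    refine .trans (leads_down _ hp i.val 0 i rfl (by omega)) ?_
    refine .trans (leads_up _ hp _ (by omega) 0 i (by simp)) ?_
    have := leads_scan (isScan_scanLetter w (.cmp, i) w[p]) (p := p + 1) hp (p + 1) 0 (by omega)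
    simpa [scanLetter] using this
  · exact leads_frontier (d := .right) hp rfl rfl
  all_goals exact hq.elim

end Run

/-! ### The fold over the input decides membership -/

section Fold

variable {n : ℕ} [NeZero n]

theorem afterCompare_of_lt (r : Bool) {i : Fin n} (h : i.val + 1 < n) :
    afterCompare r i = (if r then .cmp else .skip, i + 1) := by
  simp [afterCompare, h]

theorem afterCompare_of_eq (r : Bool) {i : Fin n} (h : i.val + 1 = n) :
    afterCompare r i = (if r then .done else .cmp, 0) := by
  have : i + 1 = 0 := Fin.ext (by rw [Fin.val_add_eq_ite]; rcases n with _ | _ | n <;> simp_all)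
  simp [afterCompare, h, this]

/-- The end of a block is reached in phase `skip`. -/
theorem foldl_scanLetter_skip (x : List Letter) :
    ∀ (l : List Letter) (i : Fin n), l ≠ [] → i.val + l.length = n →
      l.foldl (scanLetter x) (.skip, i) = (.cmp, 0)
  | [], _, h, _ => absurd rfl h
  | [σ], i, _, h => by
    simpa [scanLetter] using afterCompare_of_eq false h
  | σ :: τ :: l, i, _, h => by
    have hi : i.val + 1 < n := by simp at h; omega
    rw [List.foldl_cons]
    simp only [scanLetter, afterCompare_of_lt _ hi, Bool.false_eq_true, if_false]
    refine foldl_scanLetter_skip x (τ :: l) (i + 1) (by simp) ?_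
    rw [Fin.val_add_one_of_lt' hi]
    simp at h ⊢
    omega

/-- The end of a block is reached in phase `cmp`. -/
theorem foldl_scanLetter_cmp {x : List Letter} (hx : n ≤ x.length) :
    ∀ (l : List Letter) (i : Fin n), l ≠ [] → i.val + l.length = n →
      l.foldl (scanLetter x) (.cmp, i) =
        (if l = (x.take n).drop i then .done else .cmp, 0)
  | [], _, h, _ => absurd rfl h
  | [σ], i, _, h => by
    have h' : i.val + 1 = n := h
    have hi : i.val < x.length := by omega
    have e : (x.take n).drop i = [x[i.val]] := by
      rw [List.drop_eq_getElem_cons (by simp; omega)]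
      simp [h']
    rw [e, List.foldl_cons, List.foldl_nil]
    simp only [scanLetter, afterCompare_of_eq _ h']
    simp [hi, eq_comm]
  | σ :: τ :: l, i, _, h => by
    have hi : i.val + 1 < n := by simp at h; omega
    have hix : i.val < x.length := by omega
    have e : (x.take n).drop i = x[i.val] :: (x.take n).drop (i.val + 1) := by
      rw [List.drop_eq_getElem_cons (by simp; omega)]
      simp
    have hi' : (i + 1 : Fin n).val = i.val + 1 := Fin.val_add_one_of_lt' hi
    have hl : (i + 1 : Fin n).val + (τ :: l).length = n := by
      rw [hi']; simp at h ⊢; omega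
    rw [List.foldl_cons, e]
    simp only [scanLetter, afterCompare_of_lt _ hi]
    by_cases hσ : x[i.val]? = some σ
    · have hσ' : x[i.val] = σ := by simpa [hix] using hσ
      simp only [hσ, decide_true, if_true]
      rw [foldl_scanLetter_cmp hx (τ :: l) (i + 1) (by simp) hl, hi']
      simp [hσ']
    · have hσ' : x[i.val] ≠ σ := by simpa [hix] using hσ
      simp only [hσ, decide_false, Bool.false_eq_true, if_false]
      rw [foldl_scanLetter_skip x (τ :: l) (i + 1) (by simp) hl]
      simp [hσ'.symm]

theorem foldl_scanLetter_done (x : List Letter) :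
    ∀ (l : List Letter) (i : Fin n),
      l.foldl (scanLetter x) (.done, i) = (.done, i + Fin.ofNat n l.length)
  | [], i => by simp
  | σ :: l, i => by
    rw [List.foldl_cons]
    simp only [scanLetter]
    rw [foldl_scanLetter_done x l (i + 1)]
    refine Prod.ext rfl (Fin.ext ?_)
    simp [Fin.val_add, add_comm, add_left_comm]

/-- The phase `done` is not entered within a block. -/
theorem foldl_scanLetter_ne_done (x : List Letter) :
    ∀ (l : List Letter) (q : Phase × Fin n), q.1 = .skip ∨ q.1 = .cmp → q.2.val + l.length < n →
      (l.foldl (scanLetter x) q).1 ≠ .done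
  | [], q, hq, _ => by rcases hq with hq | hq <;> simp [hq]
  | σ :: l, q, hq, h => by
    have hi : q.2.val + 1 < n := by simp at h; omega
    have hl : (q.2 + 1 : Fin n).val + l.length < n := by
      rw [Fin.val_add_one_of_lt' hi]; simp at h; omega
    rw [List.foldl_cons]
    have key : ∀ r, (l.foldl (scanLetter x) (afterCompare r q.2)).1 ≠ .done := fun r => by
      rw [afterCompare_of_lt _ hi]
      refine foldl_scanLetter_ne_done x l _ ?_ hl
      cases r <;> simp
    obtain ⟨φ, i⟩ := q
    rcases hq with rfl | rfl <;> exact key _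

theorem exists_blocks_of_dvd {α : Type*} (n k : ℕ) :
    ∀ l : List α, l.length = n * k → ∃ L : List (List α), (∀ y ∈ L, y.length = n) ∧ l = L.flatten := by
  induction k with
  | zero => intro l h; exact ⟨[], by simp, by simpa using h⟩
  | succ k ih =>
    intro l h
    rw [mul_add, mul_one] at h
    obtain ⟨L, hL, e⟩ := ih (l.drop n) (by simp; omega)
    refine ⟨l.take n :: L, ?_, by rw [List.flatten_cons, ← e, List.take_append_drop]⟩
    simp only [List.mem_cons, forall_eq_or_imp]
    exact ⟨by simp; omega, hL⟩

theorem length_flatten_of_blocks {α : Type*} {n : ℕ} {L : List (List α)}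
    (hL : ∀ y ∈ L, y.length = n) : L.flatten.length = L.length * n := by
  have e : L.map List.length = List.replicate L.length n := by
    rw [List.eq_replicate_iff]; simpa using hL
  rw [List.length_flatten, e, List.sum_replicate, smul_eq_mul]

/-- Processing the blocks after the first one ends in acceptance iff the first one occurs. -/
theorem foldl_scanLetter_eq_done_iff {x : List Letter} (hx : n ≤ x.length) (m : ℕ) :
    ∀ l : List Letter, l.length ≤ m →
      (l.foldl (scanLetter x) ((.cmp, 0) : Phase × Fin n) = (.done, 0) ↔
        ∃ L : List (List Letter), (∀ y ∈ L, y.length = n) ∧ x.take n ∈ L ∧ l = L.flatten) := by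
  have hn := Nat.pos_of_neZero n
  induction m with
  | zero =>
    intro l hl
    obtain rfl : l = [] := by simpa using hl
    refine ⟨fun h => by simp at h, ?_⟩
    rintro ⟨L, hL, hmem, h⟩
    have h₀ := length_flatten_of_blocks hL
    have := List.length_pos_of_mem hmem
    rw [← h, List.length_nil] at h₀
    nlinarith
  | succ m ih =>
    intro l hl
    rcases Nat.lt_or_ge l.length n with hlt | hge
    · refine ⟨fun h => absurd (congrArg Prod.fst h)
        (foldl_scanLetter_ne_done x l (.cmp, 0) (.inr rfl) (by simpa using hlt)), ?_⟩
      rintro ⟨L, hL, hmem, rfl⟩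
      rw [length_flatten_of_blocks hL] at hlt
      have := List.length_pos_of_mem hmem
      nlinarith
    · have hlen : (l.take n).length = n := by simp [hge]
      have hfold := foldl_scanLetter_cmp hx (l.take n) 0
        (by rw [← List.length_pos_iff, hlen]; exact hn) (by simp [hge])
      conv_lhs => rw [← List.take_append_drop n l, List.foldl_append, hfold]
      -- After a matching block only divisibility of the remaining length by `n` matters. Otherwise
      -- the fold is back in `(.cmp, 0)` with a shorter word.
      by_cases e : l.take n = x.take n
      · rw [if_pos (by simpa using e), foldl_scanLetter_done, zero_add]
        have hz : Fin.ofNat n (l.drop n).length = 0 ↔ n ∣ (l.drop n).length := by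
          rw [Fin.ext_iff, Nat.dvd_iff_mod_eq_zero]; rfl
        rw [Prod.mk.injEq, hz]
        constructor
        · rintro ⟨-, k, hk⟩
          obtain ⟨L, hL, hlL⟩ := exists_blocks_of_dvd n k _ hk
          refine ⟨l.take n :: L, ?_, by simp [e], by
            rw [List.flatten_cons, ← hlL, List.take_append_drop]⟩
          simp only [List.mem_cons, forall_eq_or_imp]
          exact ⟨hlen, hL⟩
        · rintro ⟨L, hL, -, rfl⟩
          refine ⟨rfl, ?_⟩
          rw [List.length_drop, length_flatten_of_blocks hL]
          exact Nat.dvd_sub (dvd_mul_left _ _) dvd_rfl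
      · rw [if_neg (by simpa using e), ih _ (by simp; omega)]
        constructor
        · rintro ⟨L, hL, hmem, h⟩
          refine ⟨l.take n :: L, ?_, by simp [hmem], by
            rw [List.flatten_cons, ← h, List.take_append_drop]⟩
          simp only [List.mem_cons, forall_eq_or_imp]
          exact ⟨hlen, hL⟩
        · rintro ⟨_ | ⟨y, L⟩, hL, hmem, rfl⟩
          · simp at hmem
          · simp only [List.mem_cons, forall_eq_or_imp] at hL
            have ht : (y :: L).flatten.take n = y := by simp [← hL.1]
            rw [ht] at e
            refine ⟨L, hL.2, ?_, by simp [← hL.1]⟩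
            exact (List.mem_cons.1 hmem).resolve_left (Ne.symm e)

theorem mem_J_iff_foldl_scanLetter (w : List Letter) :
    w ∈ J n ↔ w.foldl (scanLetter w) ((.skip, 0) : Phase × Fin n) = (.done, 0) := by
  have hn := Nat.pos_of_neZero n
  rcases Nat.lt_or_ge w.length n with hlt | hge
  · constructor
    · rintro ⟨x, xs, rfl, -, -, -, rfl⟩
      simp at hlt
    · intro h
      exact absurd (congrArg Prod.fst h)
        (foldl_scanLetter_ne_done w w (.skip, 0) (.inl rfl) (by simpa using hlt))
  · have hlen : (w.take n).length = n := by simp [hge]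
    have hfold := foldl_scanLetter_skip w (w.take n) (0 : Fin n)
      (by rw [← List.length_pos_iff, hlen]; exact hn) (by simp [hge])
    -- Only the list being folded is split; the `w` inside `scanLetter w` must stay whole as the
    -- reference word.
    conv_rhs =>
      enter [1, 3]
      rw [← List.take_append_drop n w]
    rw [List.foldl_append, hfold, foldl_scanLetter_eq_done_iff hge _ _ le_rfl]
    constructor
    · rintro ⟨x, xs, rfl, -, hxs, hmem, rfl⟩
      exact ⟨xs, hxs, by simpa using hmem, by simp⟩
    · rintro ⟨L, hL, hmem, h⟩
      exact ⟨w.take n, L, hlen, List.length_pos_of_mem hmem, hL, hmem, by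
        rw [← h, List.take_append_drop]⟩

end Fold

/-! ### The accepted language -/

section Language

open RewritingAutomaton

variable {n : ℕ} [NeZero n]

/-- Keeps the counter at most the number of letters processed, as the comparison in
`leads_scanLetter` requires. -/
theorem val_scanLetter_le (x : List Letter) (q : Phase × Fin n) (σ : Letter) :
    (scanLetter x q σ).2.val ≤ q.2.val + 1 := by
  have : (scanLetter x q σ).2 = q.2 + 1 := by
    obtain ⟨_ | _ | _ | _ | _ | _, i⟩ := q <;> rfl
  rw [this, Fin.val_add]
  refine (Nat.mod_le _ _).trans (Nat.add_le_add_left ?_ _)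
  rw [Fin.val_one']
  exact Nat.mod_le _ _

theorem leads_foldl_scanLetter (w : List Letter) (p : ℕ) (hp : p ≤ w.length) :
    let q := (w.take p).foldl (scanLetter w) ((.skip, 0) : Phase × Fin n)
    q.1.IsScan ∧ q.2.val ≤ p ∧
      (blockAutomaton n).Leads (w.map Sum.inl) (.skip, 0) 1 (markedTape w p) q (p + 1) := by
  induction p with
  | zero =>
    rw [markedTape_zero]
    exact ⟨trivial, by simp, .refl⟩
  | succ p ih =>
    obtain ⟨h₁, h₂, h₃⟩ := ih (by omega)
    rw [List.take_succ_eq_append_getElem hp, List.foldl_append]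
    exact ⟨isScan_scanLetter _ _ _, (val_scanLetter_le _ _ _).trans (by omega),
      h₃.trans (leads_scanLetter h₁ hp fun _ => h₂)⟩

theorem not_step_of_readCell_eq_none {α X Q : Type*} {M : RewritingAutomaton α X Q}
    {c c' : Config α X Q} (h : readCell c.tape c.pos = none) : ¬ M.Step c c' := by
  rintro ⟨s, g, d, hs, -⟩
  simp [h] at hs

/-- If one halting configuration is reachable, then all halting computations end there. -/
theorem eq_of_halting {α X Q : Type*} {M : RewritingAutomaton α X Q} (hM : M.IsDeterministic)
    {c₀ c c' : Config α X Q} (h : ReflTransGen M.Step c₀ c) (h' : ReflTransGen M.Step c₀ c')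
    (hc : ∀ d, ¬ M.Step c d) (hc' : ∀ d, ¬ M.Step c' d) : c = c' := by
  rcases ReflTransGen.total_of_right_unique (step_rightUnique_of_isDeterministic hM) h h' with h | h
  · exact (ReflTransGen.cases_head h).resolve_right fun ⟨d, hd, _⟩ => hc d hd
  · exact ((ReflTransGen.cases_head h).resolve_right fun ⟨d, hd, _⟩ => hc' d hd).symm

theorem length_tape_of_reachable {α X Q : Type*} {M : RewritingAutomaton α X Q} {w : List α}
    {c : Config α X Q} (h : M.Reachable w c) : c.tape.length = w.length := by
  induction h with
  | refl => simp [init]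
  | tail _ hbc ih =>
    obtain ⟨s, g, d, -, -, -, ht, -⟩ := hbc
    rw [ht, ← ih]
    unfold writeCell
    split <;> simp

theorem blockAutomaton_language : (blockAutomaton n).language = J n := by
  ext w
  rw [mem_J_iff_foldl_scanLetter]
  obtain ⟨hscan, -, hrun⟩ := leads_foldl_scanLetter (n := n) w w.length le_rfl
  rw [List.take_length] at hscan hrun
  generalize w.foldl (scanLetter w) ((.skip, 0) : Phase × Fin n) = q at hscan hrun
  constructor
  · rintro ⟨c, hr, -, hpos⟩
    by_contra hq
    obtain ⟨V, hV⟩ := hrun ∅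
    -- Among the scanning states only `(.done, 0)` can move on the right end-marker. Any other one
    -- halts there, and determinism then rules out the halting configuration `c` beyond it.
    have hhalt : ∀ d, ¬ (blockAutomaton n).Step ⟨q, w.length + 1, markedTape w w.length, V⟩ d := by
      rintro d ⟨s, g, e, hs, ⟨hm, -⟩, -⟩
      rw [readCell_markedTape_end, Option.some_inj] at hs
      subst hs
      obtain ⟨_ | _ | _ | _ | _ | _, i⟩ := q
      case done =>
        have hi : i ≠ 0 := fun hi => hq (by rw [hi])
        simp [blockMove, hi] at hm
      all_goals simp [blockMove] at hm
    have hc : readCell c.tape c.pos = none := by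
      simp [hpos, readCell, length_tape_of_reachable hr]
    have := eq_of_halting (marking_isDeterministic _ _ _) hV hr hhalt
      fun d => not_step_of_readCell_eq_none hc
    rw [← this] at hpos
    simp at hpos
  · rintro rfl
    have hlast := leads_of_move (move := blockMove n) (start := (.skip, 0))
      (final := {(.done, 0)}) (q := (.done, 0)) (q' := (.done, 0)) (d := .right)
      (readCell_markedTape_end w w.length) (by simp [blockMove]) rfl
    obtain ⟨V, hV⟩ := hrun.trans hlast ∅
    exact ⟨_, hV, rfl, rfl⟩

end Language

theorem theorem7 :
    (∃ C : ℕ, ∀ n : ℕ, 0 < n →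
      ∃ (Q : Type) (_ : Fintype Q) (M : RewritingAutomaton Letter Letter Q),
        M.IsOneLimited ∧ M.IsDeterministic ∧ M.IsAlwaysMarking ∧
          Fintype.card Q ≤ C * n ∧ M.language = J n) ∧
    (∀ n : ℕ, 0 < n → ∀ (Q : Type*) [Fintype Q] (A : TwoWayNFA Letter Q),
      A.language = J n → (2 : ℝ) ^ (((n : ℝ) - 1) / 2) ≤ (Fintype.card Q : ℝ)) := by

  -- States are pairs of a phase and a counter modulo `n`, so the constant is the number of phases.
  refine ⟨⟨Fintype.card Phase, fun n hn => ?_⟩, fun n hn Q _ A hA =>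
    rpow_le_card_of_language_eq_J hn A hA⟩
  have : NeZero n := ⟨hn.ne'⟩
  exact ⟨Phase × Fin n, inferInstance, blockAutomaton n,
    RewritingAutomaton.marking_isOneLimited _ _ _, RewritingAutomaton.marking_isDeterministic _ _ _,
    RewritingAutomaton.marking_isAlwaysMarking _ _ _, by simp, blockAutomaton_language⟩
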